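/- Let $\mathcal H_\kappa$ be a real reproducing kernel Hilbert space on a set $\mathcal X$ with kernel $\kappa$, let $x_1,\dots,x_N\in\mathcal X$ satisfy $\kappa(x_i,x_i)\le 1$ for all $i$, and let $K=[\kappa(x_i,x_j)]_{i,j=1}^N$, with orthonormal eigenvectors $v_1,\dots,v_N\in\mathbb R^N$ and eigenvalues $\lambda_1\ge\dots\ge\lambda_N\ge 0$. Let $1\le r<N$, $r\le m$, let $K_r$ be a best approximation of $K$ in the Frobenius norm among the matrices of rank at most $r$, and let $\Delta=(\lambda_r-\lambda_{r+1})/N$. Given sampled points $\hat x_1,\dots,\hat x_m\in\{x_1,\dots,x_N\}$ (repetitions allowed), let $\hat\lambda_1\ge\dots\ge\hat\lambda_m$ and $u_1,\dots,u_m$ be the eigenvalues and orthonormal eigenvectors of $\widehat K=[\kappa(\hat x_i,\hat x_j)]_{i,j=1}^m$, let $K_b=[\kappa(x_i,\hat x_j)]_{N\times m}$, and, if $\hat\lambda_r>0$, let $\widehat K_r=K_b\big(\sum_{i=1}^r\hat\lambda_i^{-1}u_iu_i^\top\big)K_b^\top$ be the Nyström approximation of rank $r$. Define operators on $\mathcal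 H_\kappa$ by $L_Nf=\frac1N\sum_{i=1}^N f(x_i)\,\kappa(x_i,\cdot)$ and $L_mf=\frac1m\sum_{i=1}^m f(\hat x_i)\,\kappa(\hat x_i,\cdot)$, and the Hilbert–Schmidt norm $\|L\|_{HS}=\big(\sum_{i,j}\langle\varphi_i,L\varphi_j\rangle^2\big)^{1/2}$, where $\varphi_j=\lambda_j^{-1/2}\sum_{i=1}^N (v_j)_i\,\kappa(x_i,\cdot)$ are the orthonormal eigenfunctions of $L_N$ and the sum runs over the indices with $\lambda_i,\lambda_j>0$. (1) For every choice of the sampled points with $\Delta>3\|L_N-L_m\|_{HS}$, one has $\hat\lambda_r>0$ and $$\|K_r-\widehat K_r\|_F\le\frac{4N\|L_N-L_m\|_{HS}}{\Delta-\|L_N-L_m\|_{HS}}\le\frac{6N\|L_N-L_m\|_{HS}}{\Delta}.$$ (2) For all $c>0$ and $\delta\in(0,1)$ there is a constant $C$, depending only on $c$ and $\delta$, such that the following holds for all data as above: if $\Delta\ge c$ and $\Delta>12\ln(2/\delta)/\sqrt m$, and if $\hat x_1,\dots,\hat x_m$ are drawn independently and uniformly from $x_1,\dots,x_N$, then with probability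 at least $1-\delta$ one has $\hat\lambda_r>0$ and $$\|K_r-\widehat K_r\|_F\le C\,\frac{N}{\sqrt m}.$$ -/

import Mathlib

open scoped Matrix InnerProductSpace
open MeasureTheory

universe u v

-- Norms of real matrices are Frobenius norms.
attribute [local instance] Matrix.frobeniusNormedAddCommGroup

noncomputable section

namespace Nystrom

/-- `(w i, lam i)`, `i = 1, …, n`, are the eigenvectors and eigenvalues of the real matrix `A`:
the eigenvectors form an orthonormal basis, the eigenvalues are in descending order. -/
structure IsEigensystem {n : ℕ} (A : Matrix (Fin n) (Fin n) ℝ)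
    (w : OrthonormalBasis (Fin n) ℝ (EuclideanSpace ℝ (Fin n))) (lam : Fin n → ℝ) : Prop where
  antitone : Antitone lam
  mulVec_eq : ∀ i, A *ᵥ (w i).ofLp = lam i • (w i).ofLp

/-- Every symmetric real matrix has such an eigensystem. -/
theorem exists_isEigensystem {n : ℕ} (A : Matrix (Fin n) (Fin n) ℝ) (hA : A.IsHermitian) :
    ∃ w lam, IsEigensystem A w lam := by
  have hS := Matrix.isSymmetric_toEuclideanLin_iff.mpr hA
  refine ⟨hS.eigenvectorBasis (finrank_euclideanSpace_fin),
    hS.eigenvalues (finrank_euclideanSpace_fin), hS.eigenvalues_antitone _, fun i => ?_⟩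
  exact congrArg WithLp.ofLp (hS.apply_eigenvectorBasis (finrank_euclideanSpace_fin) i)

/-- `B` is a best approximation of `A` of rank (at most) `r` in the Frobenius norm. -/
def IsBestRankApprox {n : ℕ} (A : Matrix (Fin n) (Fin n) ℝ) (r : ℕ)
    (B : Matrix (Fin n) (Fin n) ℝ) : Prop :=
  B.rank ≤ r ∧ ∀ C : Matrix (Fin n) (Fin n) ℝ, C.rank ≤ r → ‖A - B‖ ≤ ‖A - C‖

/-- The normalized eigengap `(λ_r - λ_{r+1}) / N`, the eigenvalues `λ_1 ≥ … ≥ λ_N` being listed as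
`lam 0, …, lam (N - 1)`. -/
def eigengap {N : ℕ} (lam : Fin N → ℝ) (r : ℕ) (hrN : r < N) : ℝ :=
  (lam ⟨r - 1, by omega⟩ - lam ⟨r, hrN⟩) / N

section RKHS

variable {X : Type u} (H : Type v) [NormedAddCommGroup H] [InnerProductSpace ℝ H]
  [CompleteSpace H] [RKHS ℝ H X ℝ]

/-- The kernel function `κ(x, ·)`, an element of the reproducing kernel Hilbert space `H`. -/
def kfun (x : X) : H := RKHS.kerFun H x (1 : ℝ)

/-- The kernel `κ` of the reproducing kernel Hilbert space `H`, as a real-valued function. -/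
def kappa (x y : X) : ℝ := RKHS.kernel H x y (1 : ℝ)

/-- The matrix `[κ(x_i, y_j)]`. -/
def kernelMatrix {a b : ℕ} (x : Fin a → X) (y : Fin b → X) : Matrix (Fin a) (Fin b) ℝ :=
  Matrix.of fun i j => kappa H (x i) (y j)

/-- The integral operator `f ↦ (1/n) ∑ i, f(x_i) κ(x_i, ·)` on `H` of the points `x`. -/
def integralOp {n : ℕ} (x : Fin n → X) : H →ₗ[ℝ] H where
  toFun f := (n : ℝ)⁻¹ • ∑ i, f (x i) • kfun H (x i)
  map_add' f g := by simp [add_smul, Finset.sum_add_distrib]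
  map_smul' c f := by simp [Finset.smul_sum, smul_smul, mul_left_comm]

/-- The functions `φ_j = λ_j^{-1/2} ∑ i, V_{i,j} κ(x_i, ·)`. For `λ_j > 0` these are the
orthonormal eigenfunctions of the integral operator of `x`, and they span the same space as the
functions `κ(x_i, ·)`; for `λ_j = 0` the value is `0`. -/
def eigenfun {n : ℕ} (x : Fin n → X)
    (w : OrthonormalBasis (Fin n) ℝ (EuclideanSpace ℝ (Fin n))) (lam : Fin n → ℝ)
    (j : Fin n) : H :=
  (√(lam j))⁻¹ • ∑ i, (w j) i • kfun H (x i)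

variable {H} in
/-- The Hilbert–Schmidt norm of `L`, expanded along a family `φ` (indices with `φ_j = 0` do not
contribute). -/
def hsNorm {n : ℕ} (φ : Fin n → H) (L : H →ₗ[ℝ] H) : ℝ :=
  √(∑ i, ∑ j, ⟪φ i, L (φ j)⟫_ℝ ^ 2)

/-- The Nyström approximation `K_b Ŵ K_bᵀ` of rank `r` computed from the points `x`, the sampled
points `y`, and the eigenvectors `w` and eigenvalues `mu` of the sample kernel matrix, where
`Ŵ = ∑ i ≤ r, (1/mu_i) w_i w_iᵀ` and `K_b = [κ(x_i, y_j)]`. -/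
def nystromApprox {N m : ℕ} (x : Fin N → X) (y : Fin m → X)
    (w : OrthonormalBasis (Fin m) ℝ (EuclideanSpace ℝ (Fin m))) (mu : Fin m → ℝ)
    (r : ℕ) (hrm : r ≤ m) : Matrix (Fin N) (Fin N) ℝ :=
  kernelMatrix H x y *
    (∑ i : Fin r, (mu (Fin.castLE hrm i))⁻¹ •
      Matrix.vecMulVec (w (Fin.castLE hrm i)).ofLp (w (Fin.castLE hrm i)).ofLp) *
    (kernelMatrix H x y)ᵀ

end RKHS

/-- The law of `m` indices drawn independently and uniformly from `{1, …, N}`. -/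
def sampleLaw (N m : ℕ) : Measure (Fin m → Fin N) :=
  Measure.pi fun _ => ProbabilityTheory.uniformOn (Set.univ : Set (Fin N))

end Nystrom

end

open Nystrom

/-!
# Perturbation bound for the Nyström approximation

Let `κ_i = κ(x_i, ·)`. The truncation of `K = [⟪κ_i, κ_j⟫]` to its `r` leading eigenvalues is the
Gram matrix `[⟪κ_i, P κ_j⟫]`, where `P` is the orthogonal projection to the span of the `r` leading
eigenfunctions of the integral operator `L_N`. The Nyström approximation is `[⟪κ_i, Q κ_j⟫]`, with
`Q` the corresponding projection for the operator `L_m` of the sample. Since `‖κ_i‖ ≤ 1`, each entry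
of the difference is at most `‖P - Q‖`, and the Frobenius norm is at most `N ‖P - Q‖`.

Let `ε` be the Hilbert–Schmidt norm of `L_N - L_m`. By Weyl's inequality
(`eigenvalue_sub_hsNorm_le`) the `r` leading eigenvalues of `L_m` exceed the eigenvalues of `L_N`
after the first `r` by at least `Δ - ε`. The Davis–Kahan argument (`sum_inner_eigenfun_sq_le`) then
bounds the part of `Q` outside the range of `P` by `ε / (Δ - ε)`, and since `P` and `Q` have equal
rank this gives `‖P - Q‖ ≤ √2 ε / (Δ - ε)` (`sq_spectralProjection_sub_le`).

The eigengap makes the best approximation of rank at most `r` unique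
(`IsBestRankApprox.eq_spectralTruncation`), so every best approximation is the spectral truncation.
The norm of the difference from a competitor `B` is compared by projecting to the range of `B`.

For independent uniform samples, `L_N - L_m` is the deviation of a sample average of rank-one
operators of norm at most `1`, which live in a Euclidean space of coefficients
(`hsNorm_integralOp_sub`). Its mean norm is at most `1 / √m` by orthogonality of the increments, and
a bounded-difference inequality controls the fluctuation, so that `ε < 4 log (2 / δ) / √m` with
probability at least `1 - δ` (`ofReal_one_sub_le_sampleLaw`). The hypothesis on `Δ` is then
`3 ε < Δ`.
-/

/-! ### Best low-rank approximation of a positive semidefinite matrix -/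

namespace Nystrom

theorem sum_fin_castLE {N r : ℕ} (h : r ≤ N) (g : Fin N → ℝ) :
    ∑ i : Fin r, g (Fin.castLE h i) = ∑ i : Fin N, if (i : ℕ) < r then g i else 0 := by
  rw [← Finset.sum_filter]
  refine Finset.sum_bij (fun i _ => Fin.castLE h i) (by simp) ?_ ?_ (by simp)
  · intro a _ b _ hab
    exact Fin.castLE_injective h hab
  · intro b hb
    exact ⟨⟨b, by simpa using hb⟩, by simp, rfl⟩

theorem frobenius_norm_sq {a b : ℕ} (A : Matrix (Fin a) (Fin b) ℝ) :
    ‖A‖ ^ 2 = ∑ i, ∑ j, A i j ^ 2 := by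
  rw [Matrix.frobenius_norm_def, ← Real.sqrt_eq_rpow, Real.sq_sqrt (by positivity)]
  simp

theorem frobenius_norm_sq_eq_sum_mulVec {n : ℕ} (A : Matrix (Fin n) (Fin n) ℝ)
    (w : OrthonormalBasis (Fin n) ℝ (EuclideanSpace ℝ (Fin n))) :
    ‖A‖ ^ 2 = ∑ i, ‖A.toEuclideanLin (w i)‖ ^ 2 := by
  have h : ∀ k, ∑ j, A k j ^ 2 = ∑ i, (A.toEuclideanLin (w i)).ofLp k ^ 2 := by
    intro k
    have h1 := w.sum_sq_norm_inner_left (WithLp.toLp 2 (A k))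
    rw [EuclideanSpace.norm_sq_eq] at h1
    simp only [Real.norm_eq_abs, sq_abs] at h1
    rw [← h1]
    refine Finset.sum_congr rfl fun i _ => ?_
    simp [PiLp.inner_apply, Matrix.mulVec, dotProduct, mul_comm]
  rw [frobenius_norm_sq]
  simp_rw [h, EuclideanSpace.norm_sq_eq, Real.norm_eq_abs, sq_abs]
  rw [Finset.sum_comm]

theorem sum_norm_sq_starProjection {n : ℕ} (W : Submodule ℝ (EuclideanSpace ℝ (Fin n)))
    (w : OrthonormalBasis (Fin n) ℝ (EuclideanSpace ℝ (Fin n))) :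
    ∑ i, ‖W.starProjection (w i)‖ ^ 2 = Module.finrank ℝ W := by
  let b := stdOrthonormalBasis ℝ W
  have h : ∀ i, ‖W.starProjection (w i)‖ ^ 2 =
      ∑ k, ⟪w i, (b k : EuclideanSpace ℝ (Fin n))⟫_ℝ ^ 2 := by
    intro i
    rw [Submodule.starProjection_apply, ← Submodule.coe_norm, ← b.sum_sq_norm_inner_left]
    refine Finset.sum_congr rfl fun k _ => ?_
    rw [Real.norm_eq_abs, sq_abs, Submodule.inner_orthogonalProjectionOnto_eq_of_mem_right,
      real_inner_comm]
  simp_rw [h]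
  rw [Finset.sum_comm]
  have h2 : ∀ k, ∑ i, ⟪w i, (b k : EuclideanSpace ℝ (Fin n))⟫_ℝ ^ 2 = 1 := by
    intro k
    have := w.sum_sq_norm_inner_right (b k : EuclideanSpace ℝ (Fin n))
    simp only [Real.norm_eq_abs, sq_abs] at this
    rw [this, ← Submodule.coe_norm, b.norm_eq_one, one_pow]
  simp [h2]

/-- Among weights `0 ≤ q i ≤ 1` of total mass at most `r`, only the indicator of the first `r`
indices attains the minimum of `∑ a i (1 - q i)` when `a` is antitone with a gap at `r`. The additional term
`R` is a nonnegative excess, which then vanishes as well. -/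
theorem weights_eq_indicator {n r : ℕ} (hrn : r < n) (hr : 1 ≤ r) {a q : Fin n → ℝ} {R : ℝ}
    (ha : Antitone a) (ha0 : ∀ i, 0 ≤ a i) (hgap : a ⟨r, hrn⟩ < a ⟨r - 1, by omega⟩)
    (hq0 : ∀ i, 0 ≤ q i) (hq1 : ∀ i, q i ≤ 1) (hq : ∑ i, q i ≤ r) (hR : 0 ≤ R)
    (h : ∑ i, a i * (1 - q i) + R ≤ ∑ i : Fin n, if (i : ℕ) < r then 0 else a i) :
    R = 0 ∧ ∀ i : Fin n, q i = if (i : ℕ) < r then 1 else 0 := by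
  set b := a ⟨r, hrn⟩ with hb
  set a' := a ⟨r - 1, by omega⟩ with ha'
  have hcard : ∑ i : Fin n, (if (i : ℕ) < r then (1 : ℝ) else 0) = r := by
    rw [← sum_fin_castLE hrn.le (fun _ => 1)]; simp
  have key : ∀ i : Fin n, (if (i : ℕ) < r then (a' - b) * (1 - q i) else 0)
      + b * ((if (i : ℕ) < r then 1 else 0) - q i)
      ≤ a i * (1 - q i) - (if (i : ℕ) < r then 0 else a i) := by
    intro i
    split_ifs with hi
    · have : a' ≤ a i := ha (by rw [Fin.le_def]; simp only; omega)
      nlinarith [mul_le_mul_of_nonneg_right this (sub_nonneg.2 (hq1 i))]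
    · have : a i ≤ b := ha (by rw [Fin.le_def]; simp only; omega)
      nlinarith [mul_le_mul_of_nonneg_right this (hq0 i)]
  have key2 := Finset.sum_le_sum fun i (_ : i ∈ Finset.univ) => key i
  rw [Finset.sum_add_distrib, ← Finset.mul_sum, Finset.sum_sub_distrib, Finset.sum_sub_distrib,
    hcard] at key2
  have hb0 : 0 ≤ b * (r - ∑ i, q i) := mul_nonneg (ha0 _) (by linarith)
  have hterm : ∀ i : Fin n, 0 ≤ (if (i : ℕ) < r then (a' - b) * (1 - q i) else 0) := by
    intro i
    split_ifs
    · exact mul_nonneg (by linarith) (by linarith [hq1 i])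
    · exact le_rfl
  have hs0 := Finset.sum_nonneg fun i (_ : i ∈ Finset.univ) => hterm i
  have hs : ∑ i : Fin n, (if (i : ℕ) < r then (a' - b) * (1 - q i) else 0) = 0 := by linarith
  have htop : ∀ i : Fin n, (i : ℕ) < r → q i = 1 := by
    intro i hi
    have := (Finset.sum_eq_zero_iff_of_nonneg fun i _ => hterm i).1 hs i (Finset.mem_univ i)
    rw [if_pos hi] at this
    rcases mul_eq_zero.1 this with h | h <;> linarith
  have hrest0 : ∀ i : Fin n, 0 ≤ q i - (if (i : ℕ) < r then 1 else 0) := by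
    intro i
    split_ifs with hi
    · rw [htop i hi]; simp
    · simpa using hq0 i
  have hrest : ∑ i : Fin n, (q i - (if (i : ℕ) < r then 1 else 0)) = 0 := by
    refine le_antisymm ?_ (Finset.sum_nonneg fun i _ => hrest0 i)
    rw [Finset.sum_sub_distrib, hcard]; linarith
  refine ⟨by linarith, fun i => ?_⟩
  have := (Finset.sum_eq_zero_iff_of_nonneg fun i _ => hrest0 i).1 hrest i (Finset.mem_univ i)
  linarith

/-- The matrix `∑ i < r, c i • w i (w i)ᵀ`; for an eigensystem `(w, c)` of `A` it is the spectral
truncation of `A` to its `r` leading eigenvalues. -/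
noncomputable def spectralTruncation {n : ℕ}
    (w : OrthonormalBasis (Fin n) ℝ (EuclideanSpace ℝ (Fin n))) (c : Fin n → ℝ)
    (r : ℕ) (hrn : r ≤ n) : Matrix (Fin n) (Fin n) ℝ :=
  ∑ i : Fin r, c (Fin.castLE hrn i) •
    Matrix.vecMulVec (w (Fin.castLE hrn i)).ofLp (w (Fin.castLE hrn i)).ofLp

theorem rank_spectralTruncation_le {n : ℕ}
    (w : OrthonormalBasis (Fin n) ℝ (EuclideanSpace ℝ (Fin n))) (c : Fin n → ℝ)
    (r : ℕ) (hrn : r ≤ n) : (spectralTruncation w c r hrn).rank ≤ r := by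
  have h : spectralTruncation w c r hrn =
      Matrix.of (fun (i : Fin n) (l : Fin r) => c (Fin.castLE hrn l) * w (Fin.castLE hrn l) i) *
      Matrix.of (fun (l : Fin r) (j : Fin n) => w (Fin.castLE hrn l) j) := by
    ext i j
    simp [spectralTruncation, Matrix.mul_apply, Matrix.sum_apply, Matrix.vecMulVec_apply, mul_assoc]
  rw [h]
  refine (Matrix.rank_mul_le_left _ _).trans ?_
  exact (Matrix.rank_le_width _)

theorem spectralTruncation_apply_basis {n : ℕ}
    (w : OrthonormalBasis (Fin n) ℝ (EuclideanSpace ℝ (Fin n))) (c : Fin n → ℝ)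
    (r : ℕ) (hrn : r ≤ n) (i : Fin n) :
    (spectralTruncation w c r hrn).toEuclideanLin (w i)
      = (if (i : ℕ) < r then c i else 0) • w i := by
  have h : ∀ l : Fin n, Matrix.toEuclideanLin (c l • Matrix.vecMulVec (w l).ofLp (w l).ofLp) (w i)
      = if l = i then c i • w i else 0 := by
    intro l
    have h1 := orthonormal_iff_ite.1 w.orthonormal l i
    rw [PiLp.inner_apply] at h1
    ext k
    have h2 : (w l).ofLp ⬝ᵥ (w i).ofLp = if l = i then 1 else 0 := by
      rw [← h1]; simp [dotProduct, mul_comm]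
    simp only [Matrix.toLpLin_apply, Matrix.smul_mulVec, Matrix.vecMulVec_mulVec, h2]
    split_ifs with hli
    · subst hli; simp
    · simp
  rw [spectralTruncation, map_sum, LinearMap.sum_apply]
  simp_rw [h]
  split_ifs with hi
  · rw [Finset.sum_eq_single ⟨i, hi⟩]
    · simp
    · intro b _ hb
      rw [if_neg]
      intro h
      apply hb
      ext
      simpa [Fin.ext_iff] using h
    · simp
  · rw [zero_smul]
    refine Finset.sum_eq_zero fun l _ => if_neg ?_
    rintro rfl
    exact hi l.2

/-- Eckart–Young theorem with uniqueness: for a positive semidefinite matrix with an eigengap at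
`r`, the spectral truncation is the only best approximation of rank at most `r`. -/
theorem IsBestRankApprox.eq_spectralTruncation {n : ℕ} {A B : Matrix (Fin n) (Fin n) ℝ} {r : ℕ}
    (hB : IsBestRankApprox A r B)
    {w : OrthonormalBasis (Fin n) ℝ (EuclideanSpace ℝ (Fin n))} {lam : Fin n → ℝ}
    (hw : IsEigensystem A w lam) (hlam : ∀ i, 0 ≤ lam i) (hr : 1 ≤ r) (hrn : r < n)
    (hgap : lam ⟨r, hrn⟩ < lam ⟨r - 1, by omega⟩) :
    B = spectralTruncation w lam r hrn.le := by
  set T := B.toEuclideanLin with hT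
  set W := LinearMap.range T with hW
  have hA : ∀ i, A.toEuclideanLin (w i) = lam i • w i := fun i => by
    rw [Matrix.toLpLin_apply, hw.mulVec_eq]; rfl
  have hrank : Module.finrank ℝ W = B.rank := by
    rw [B.rank_eq_finrank_range_toLin (EuclideanSpace.basisFun _ ℝ).toBasis
      (EuclideanSpace.basisFun _ ℝ).toBasis, hW, hT, Matrix.toEuclideanLin_eq_toLin_orthonormal]
  -- The projection `P` to the range of `B` splits `(A - B) (w i)` orthogonally into
  -- `(1 - P) A (w i)` and `P A (w i) - B (w i)`.
  have hdist : ∀ i, ‖(A - B).toEuclideanLin (w i)‖ ^ 2 =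
      lam i ^ 2 * (1 - ‖W.starProjection (w i)‖ ^ 2)
      + ‖lam i • W.starProjection (w i) - T (w i)‖ ^ 2 := by
    intro i
    have h0 := W.norm_sq_eq_add_norm_sq_starProjection (lam i • w i - T (w i))
    have h1 := W.norm_sq_eq_add_norm_sq_starProjection (w i)
    have hTm : T (w i) ∈ W := LinearMap.mem_range_self _ _
    rw [w.norm_eq_one, one_pow] at h1
    rw [map_sub, LinearMap.sub_apply, hA, ← hT, h0, map_sub, map_sub, map_smul, map_smul,
      Submodule.starProjection_eq_self_iff.2 hTm,
      Submodule.starProjection_orthogonal_apply_eq_zero hTm, sub_zero, norm_smul, mul_pow,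
      Real.norm_eq_abs, sq_abs, h1]
    ring
  have htr : ‖A - spectralTruncation w lam r hrn.le‖ ^ 2
      = ∑ i : Fin n, if (i : ℕ) < r then 0 else lam i ^ 2 := by
    rw [frobenius_norm_sq_eq_sum_mulVec _ w]
    refine Finset.sum_congr rfl fun i _ => ?_
    rw [map_sub, LinearMap.sub_apply, hA, spectralTruncation_apply_basis]
    split_ifs <;> simp [norm_smul]
  have hle := pow_le_pow_left₀ (norm_nonneg _)
    (hB.2 _ (rank_spectralTruncation_le w lam r hrn.le)) 2
  rw [htr, frobenius_norm_sq_eq_sum_mulVec _ w] at hle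
  simp_rw [hdist] at hle
  rw [Finset.sum_add_distrib] at hle
  obtain ⟨hR, hq⟩ := weights_eq_indicator hrn hr (a := fun i => lam i ^ 2)
    (q := fun i => ‖W.starProjection (w i)‖ ^ 2)
    (fun i j hij => pow_le_pow_left₀ (hlam j) (hw.antitone hij) 2) (fun i => sq_nonneg _)
    (pow_lt_pow_left₀ hgap (hlam _) two_ne_zero) (fun i => sq_nonneg _)
    (fun i => by
      have := W.norm_starProjection_apply_le (w i)
      rw [w.norm_eq_one] at this
      exact pow_le_one₀ (norm_nonneg _) this)
    (by rw [sum_norm_sq_starProjection, hrank]; exact_mod_cast hB.1)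
    (Finset.sum_nonneg fun i _ => sq_nonneg _) hle
  apply Matrix.toEuclideanLin.injective
  apply w.toBasis.ext
  intro i
  rw [OrthonormalBasis.coe_toBasis, spectralTruncation_apply_basis]
  have h1 := (Finset.sum_eq_zero_iff_of_nonneg fun i _ => sq_nonneg _).1 hR i (Finset.mem_univ i)
  rw [sq_eq_zero_iff, norm_eq_zero, sub_eq_zero] at h1
  rw [← hT, ← h1]
  have h2 := hq i
  have h3 := W.norm_sq_eq_add_norm_sq_starProjection (w i)
  split_ifs at h2 ⊢ with hi
  · rw [h2, w.norm_eq_one] at h3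
    have h4 : Wᗮ.starProjection (w i) = 0 := by
      rw [← norm_eq_zero, ← sq_eq_zero_iff]; linarith
    rw [Submodule.starProjection_orthogonal_val, sub_eq_zero] at h4
    rw [← h4]
  · rw [sq_eq_zero_iff, norm_eq_zero] at h2
    rw [h2]; simp

end Nystrom

/-! ### Eigenfunctions of the integral operator of a point family -/

namespace Nystrom

variable {X : Type u} {H : Type v} [NormedAddCommGroup H] [InnerProductSpace ℝ H]
  [RKHS ℝ H X ℝ]

/-- The map `f ↦ (f(x_i))_i`, the adjoint of `synthesis`. -/
noncomputable def sampling {n : ℕ} (x : Fin n → X) : H →ₗ[ℝ] EuclideanSpace ℝ (Fin n) where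
  toFun f := WithLp.toLp 2 fun i => f (x i)
  map_add' f g := by ext; simp
  map_smul' c f := by ext; simp

theorem sampling_apply {n : ℕ} (x : Fin n → X) (f : H) (i : Fin n) : sampling x f i = f (x i) :=
  rfl

variable [CompleteSpace H]

theorem inner_kfun_left (y : X) (f : H) : ⟪kfun H y, f⟫_ℝ = f y := by
  rw [kfun, RKHS.kerFun_inner]; simp

theorem inner_kfun_kfun (y z : X) : ⟪kfun H y, kfun H z⟫_ℝ = kappa H y z := by
  rw [inner_kfun_left, kfun, RKHS.kerFun_apply, kappa]

/-- The map `a ↦ ∑ i, a i κ(x_i, ·)` from coefficient vectors to the reproducing kernel Hilbert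
space `H`. -/
noncomputable def synthesis (H : Type v) [NormedAddCommGroup H] [InnerProductSpace ℝ H]
    [CompleteSpace H] [RKHS ℝ H X ℝ] {n : ℕ} (x : Fin n → X) :
    EuclideanSpace ℝ (Fin n) →ₗ[ℝ] H where
  toFun a := ∑ i, a i • kfun H (x i)
  map_add' a b := by simp [add_smul, Finset.sum_add_distrib]
  map_smul' c a := by simp [Finset.smul_sum, smul_smul]

theorem synthesis_apply {n : ℕ} (x : Fin n → X) (a : EuclideanSpace ℝ (Fin n)) :
    synthesis H x a = ∑ i, a i • kfun H (x i) := rfl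

variable {n : ℕ} (x : Fin n → X)

theorem inner_synthesis_right (f : H) (a : EuclideanSpace ℝ (Fin n)) :
    ⟪f, synthesis H x a⟫_ℝ = ⟪sampling x f, a⟫_ℝ := by
  simp only [synthesis_apply, inner_sum, inner_smul_right,
    PiLp.inner_apply, sampling_apply]
  refine Finset.sum_congr rfl fun i _ => ?_
  rw [real_inner_comm, inner_kfun_left]; simp

theorem integralOp_eq (f : H) :
    integralOp H x f = (n : ℝ)⁻¹ • synthesis H x (sampling x f) := rfl

theorem inner_integralOp_right (f g : H) :
    ⟪f, integralOp H x g⟫_ℝ = (n : ℝ)⁻¹ * ⟪sampling x f, sampling x g⟫_ℝ := by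
  rw [integralOp_eq, inner_smul_right, inner_synthesis_right]

theorem inner_integralOp_symm (f g : H) :
    ⟪integralOp H x f, g⟫_ℝ = ⟪f, integralOp H x g⟫_ℝ := by
  rw [real_inner_comm, inner_integralOp_right, inner_integralOp_right, real_inner_comm]

theorem sampling_synthesis (a : EuclideanSpace ℝ (Fin n)) {m : ℕ} (y : Fin m → X) :
    sampling y (synthesis H x a) = WithLp.toLp 2 (kernelMatrix H y x *ᵥ a.ofLp) := by
  ext i
  rw [sampling_apply, ← inner_kfun_left]
  simp only [synthesis_apply, inner_sum, inner_smul_right,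
    inner_kfun_kfun, kernelMatrix, Matrix.mulVec, dotProduct, Matrix.of_apply]
  exact Finset.sum_congr rfl fun i _ => mul_comm _ _

section eigen

variable {x} {w : OrthonormalBasis (Fin n) ℝ (EuclideanSpace ℝ (Fin n))} {lam : Fin n → ℝ}

theorem IsEigensystem.sampling_synthesis_basis
    (hw : IsEigensystem (kernelMatrix H x x) w lam) (i : Fin n) :
    sampling x (synthesis H x (w i)) = lam i • w i := by
  rw [sampling_synthesis, hw.mulVec_eq]; rfl

theorem IsEigensystem.inner_synthesis_basis
    (hw : IsEigensystem (kernelMatrix H x x) w lam) (i j : Fin n) :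
    ⟪synthesis H x (w i), synthesis H x (w j)⟫_ℝ = if i = j then lam i else 0 := by
  rw [inner_synthesis_right, hw.sampling_synthesis_basis, real_inner_smul_left,
    orthonormal_iff_ite.1 w.orthonormal]
  simp

theorem IsEigensystem.inner_sampling_synthesis
    (hw : IsEigensystem (kernelMatrix H x x) w lam)
    (a : EuclideanSpace ℝ (Fin n)) (i : Fin n) :
    ⟪sampling x (synthesis H x a), w i⟫_ℝ = lam i * ⟪w i, a⟫_ℝ := by
  rw [← inner_synthesis_right, real_inner_comm, inner_synthesis_right,
    hw.sampling_synthesis_basis, real_inner_smul_left]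

theorem IsEigensystem.eigenvalue_nonneg
    (hw : IsEigensystem (kernelMatrix H x x) w lam) (i : Fin n) :
    0 ≤ lam i := by
  have h := hw.inner_synthesis_basis i i
  rw [if_pos rfl] at h
  rw [← h]; exact real_inner_self_nonneg

theorem eigenfun_eq (j : Fin n) :
    eigenfun H x w lam j = (√(lam j))⁻¹ • synthesis H x (w j) := rfl

theorem IsEigensystem.inner_eigenfun
    (hw : IsEigensystem (kernelMatrix H x x) w lam)
    (i j : Fin n) (hi : 0 < lam i) :
    ⟪eigenfun H x w lam i, eigenfun H x w lam j⟫_ℝ = if i = j then 1 else 0 := by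
  rw [eigenfun_eq, eigenfun_eq, inner_smul_left, inner_smul_right, hw.inner_synthesis_basis]
  split_ifs with h
  · subst h
    have : √(lam i) ≠ 0 := (Real.sqrt_pos.2 hi).ne'
    simp only [conj_trivial]
    field_simp
    rw [Real.sq_sqrt hi.le]
  · simp

theorem IsEigensystem.synthesis_basis
    (hw : IsEigensystem (kernelMatrix H x x) w lam) (i : Fin n) :
    synthesis H x (w i) = √(lam i) • eigenfun H x w lam i := by
  rcases (hw.eigenvalue_nonneg i).eq_or_lt with h | h
  · have h1 := hw.inner_synthesis_basis i i
    rw [if_pos rfl, ← h, inner_self_eq_zero] at h1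
    rw [h1, ← h]; simp
  · rw [eigenfun_eq, smul_smul, mul_inv_cancel₀ (Real.sqrt_pos.2 h).ne', one_smul]

theorem IsEigensystem.integralOp_eigenfun
    (hw : IsEigensystem (kernelMatrix H x x) w lam) (j : Fin n) :
    integralOp H x (eigenfun H x w lam j) = (lam j / n) • eigenfun H x w lam j := by
  have h : sampling x (eigenfun H x w lam j) = (√(lam j))⁻¹ • lam j • w j := by
    rw [← hw.sampling_synthesis_basis, eigenfun_eq, map_smul]
  rw [integralOp_eq, h, map_smul, map_smul, eigenfun_eq, smul_smul, smul_smul, smul_smul]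
  congr 1
  ring

/-- Functions in the span of the `κ(x_i, ·)` expand along the eigenfunctions; those with eigenvalue
`0` vanish and do not contribute. -/
theorem IsEigensystem.sum_inner_eigenfun_smul_synthesis
    (hw : IsEigensystem (kernelMatrix H x x) w lam)
    (a : EuclideanSpace ℝ (Fin n)) :
    ∑ i, ⟪eigenfun H x w lam i, synthesis H x a⟫_ℝ • eigenfun H x w lam i
      = synthesis H x a := by
  have h : ∀ i, ⟪eigenfun H x w lam i, synthesis H x a⟫_ℝ • eigenfun H x w lam i
      = ⟪w i, a⟫_ℝ • synthesis H x (w i) := by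
    intro i
    rw [eigenfun_eq, real_inner_smul_left, real_inner_comm, inner_synthesis_right,
      hw.inner_sampling_synthesis]
    rcases (hw.eigenvalue_nonneg i).eq_or_lt with h | h
    · rw [hw.synthesis_basis, ← h]; simp
    · have hs : √(lam i) ≠ 0 := (Real.sqrt_pos.2 h).ne'
      rw [smul_smul]
      congr 1
      rw [show (√(lam i))⁻¹ * (lam i * ⟪w i, a⟫_ℝ) * (√(lam i))⁻¹
        = lam i / (√(lam i) * √(lam i)) * ⟪w i, a⟫_ℝ by field_simp,
        Real.mul_self_sqrt h.le, div_self h.ne', one_mul]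
  simp_rw [h, ← map_smul, ← map_sum, w.sum_repr']

theorem inner_kfun_eigenfun (i : Fin n) (z : X) :
    ⟪kfun H z, eigenfun H x w lam i⟫_ℝ
      = (√(lam i))⁻¹ * ∑ j, kappa H z (x j) * w i j := by
  rw [eigenfun_eq, inner_smul_right]
  congr 1
  simp only [synthesis_apply, inner_sum, inner_smul_right,
    inner_kfun_kfun]
  exact Finset.sum_congr rfl fun i _ => mul_comm _ _

end eigen

end Nystrom

/-! ### Perturbation of spectral projections -/

namespace Nystrom

section parseval

variable {E ι κ : Type*} [NormedAddCommGroup E] [InnerProductSpace ℝ E] [Fintype ι] [Fintype κ]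
  {φ : ι → E} {ψ : κ → E}

/-- Parseval's identity for a vector `f` with expansion `f = ∑ i, ⟪φ i, f⟫ φ i`. The family `φ` need
not be orthonormal: in the application some of the `φ i` vanish. -/
theorem sum_inner_mul_inner_of_reproduces {f : E} (hf : ∑ i, ⟪φ i, f⟫_ℝ • φ i = f) (g : E) :
    ∑ i, ⟪φ i, f⟫_ℝ * ⟪φ i, g⟫_ℝ = ⟪f, g⟫_ℝ := by
  conv_rhs => rw [← hf]
  simp [sum_inner, real_inner_smul_left]

theorem sum_inner_sq_of_reproduces {f : E} (hf : ∑ i, ⟪φ i, f⟫_ℝ • φ i = f) :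
    ∑ i, ⟪φ i, f⟫_ℝ ^ 2 = ‖f‖ ^ 2 := by
  rw [← real_inner_self_eq_norm_sq, ← sum_inner_mul_inner_of_reproduces hf]
  simp [sq]

theorem sum_inner_sq_le_norm_sq (hψ : Orthonormal ℝ ψ) (f : E) :
    ∑ k, ⟪f, ψ k⟫_ℝ ^ 2 ≤ ‖f‖ ^ 2 := by
  have := hψ.sum_inner_products_le f (s := Finset.univ)
  simpa [real_inner_comm] using this

theorem norm_sub_sum_inner_smul_sq (hψ : Orthonormal ℝ ψ) (f : E) :
    ‖f - ∑ k, ⟪ψ k, f⟫_ℝ • ψ k‖ ^ 2 = ‖f‖ ^ 2 - ∑ k, ⟪ψ k, f⟫_ℝ ^ 2 := by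
  rw [norm_sub_sq_real]
  have h1 : ‖∑ k, ⟪ψ k, f⟫_ℝ • ψ k‖ ^ 2 = ∑ k, ⟪ψ k, f⟫_ℝ ^ 2 := by
    rw [← real_inner_self_eq_norm_sq, hψ.inner_sum]
    simp [sq]
  have h2 : ⟪f, ∑ k, ⟪ψ k, f⟫_ℝ • ψ k⟫_ℝ = ∑ k, ⟪ψ k, f⟫_ℝ ^ 2 := by
    simp [inner_sum, real_inner_smul_right, real_inner_comm, sq]
  rw [h1, h2]; ring

/-- Let `P = ∑ ⟪φ i, ·⟫ φ i` over the `i` with `p i`, and let `Q` be the projection to the span of the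
orthonormal family `ψ`, with as many members. When the nonzero `φ i` are orthonormal, `P` is a
projection too, the square of the Hilbert–Schmidt norm of `P - Q` is `2 ∑ ⟪φ i, ψ k⟫²` over the pairs
with `¬ p i`, and it bounds the bilinear form of `P - Q`. -/
theorem sq_spectralProjection_sub_le (p : ι → Prop) [DecidablePred p] (hψ : Orthonormal ℝ ψ)
    (hφ : ∀ i, p i → ‖φ i‖ = 1)
    (hφψ : ∀ k, ∑ i, ⟪φ i, ψ k⟫_ℝ • φ i = ψ k)
    (hcard : ∑ i, (if p i then (1 : ℝ) else 0) = Fintype.card κ)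
    {f : E} (hf : ∑ i, ⟪φ i, f⟫_ℝ • φ i = f) (g : E) :
    (∑ i, (if p i then ⟪φ i, f⟫_ℝ * ⟪φ i, g⟫_ℝ else 0) - ∑ k, ⟪ψ k, f⟫_ℝ * ⟪ψ k, g⟫_ℝ) ^ 2
      ≤ 2 * (∑ i, ∑ k, if p i then 0 else ⟪φ i, ψ k⟫_ℝ ^ 2) * (‖f‖ ^ 2 * ‖g‖ ^ 2) := by
  -- `d i = (P - Q) (φ i)` if the nonzero `φ i` are orthonormal
  set d : ι → E := fun i => (if p i then φ i else 0) - ∑ k, ⟪ψ k, φ i⟫_ℝ • ψ k with hd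
  have hB : ∑ i, (if p i then ⟪φ i, f⟫_ℝ * ⟪φ i, g⟫_ℝ else 0) - ∑ k, ⟪ψ k, f⟫_ℝ * ⟪ψ k, g⟫_ℝ
      = ∑ i, ⟪φ i, f⟫_ℝ * ⟪d i, g⟫_ℝ := by
    have h1 : ∀ k, ⟪ψ k, f⟫_ℝ * ⟪ψ k, g⟫_ℝ = ∑ i, ⟪φ i, f⟫_ℝ * (⟪ψ k, φ i⟫_ℝ * ⟪ψ k, g⟫_ℝ) := by
      intro k
      rw [real_inner_comm, ← sum_inner_mul_inner_of_reproduces hf, Finset.sum_mul]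
      exact Finset.sum_congr rfl fun i _ => by rw [real_inner_comm (ψ k) (φ i)]; ring
    simp_rw [h1]
    rw [Finset.sum_comm, ← Finset.sum_sub_distrib]
    refine Finset.sum_congr rfl fun i _ => ?_
    rw [hd]
    simp only [inner_sub_left, sum_inner, real_inner_smul_left, mul_sub, Finset.mul_sum]
    split_ifs <;> simp
  have hnorm : ∀ i, ‖d i‖ ^ 2 = (if p i then 1 else 0) - ∑ k, ⟪φ i, ψ k⟫_ℝ ^ 2
      + 2 * ∑ k, if p i then 0 else ⟪φ i, ψ k⟫_ℝ ^ 2 := by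
    intro i
    have h1 := norm_sub_sum_inner_smul_sq hψ (φ i)
    have hc : ∑ k, ⟪ψ k, φ i⟫_ℝ ^ 2 = ∑ k, ⟪φ i, ψ k⟫_ℝ ^ 2 :=
      Finset.sum_congr rfl fun k _ => by rw [real_inner_comm]
    by_cases hi : p i
    · simp only [hd, if_pos hi, h1, hφ i hi, hc]; simp
    · have h2 : ‖∑ k, ⟪ψ k, φ i⟫_ℝ • ψ k‖ ^ 2 = ∑ k, ⟪ψ k, φ i⟫_ℝ ^ 2 := by
        rw [← real_inner_self_eq_norm_sq, hψ.inner_sum]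
        simp [sq]
      simp only [hd, if_neg hi, zero_sub, norm_neg, h2, hc]; ring
  have hsum : ∑ i, ‖d i‖ ^ 2 = 2 * (∑ i, ∑ k, if p i then 0 else ⟪φ i, ψ k⟫_ℝ ^ 2) := by
    simp_rw [hnorm]
    rw [Finset.sum_add_distrib, Finset.sum_sub_distrib, hcard, ← Finset.mul_sum,
      Finset.sum_comm (f := fun i k => ⟪φ i, ψ k⟫_ℝ ^ 2)]
    have : ∀ k, ∑ i, ⟪φ i, ψ k⟫_ℝ ^ 2 = 1 := fun k => by
      rw [sum_inner_sq_of_reproduces (hφψ k), hψ.1 k, one_pow]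
    simp [this]
  rw [hB]
  refine (Finset.sum_mul_sq_le_sq_mul_sq _ _ _).trans ?_
  rw [sum_inner_sq_of_reproduces hf, ← hsum]
  calc ‖f‖ ^ 2 * ∑ i, ⟪d i, g⟫_ℝ ^ 2 ≤ ‖f‖ ^ 2 * ∑ i, ‖d i‖ ^ 2 * ‖g‖ ^ 2 := by
        gcongr with i
        rw [← mul_pow, ← sq_abs]
        exact pow_le_pow_left₀ (abs_nonneg _) (abs_real_inner_le_norm _ _) 2
    _ = _ := by rw [← Finset.sum_mul]; ring

end parseval

section hilbertSchmidt

variable {H : Type*} [NormedAddCommGroup H] [InnerProductSpace ℝ H] {n : ℕ} {φ : Fin n → H}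
  {T : H →ₗ[ℝ] H}

theorem sum_norm_sq_eq_hsNorm_sq
    (hT : ∀ j, ∑ i, ⟪φ i, T (φ j)⟫_ℝ • φ i = T (φ j)) :
    ∑ j, ‖T (φ j)‖ ^ 2 = hsNorm φ T ^ 2 := by
  rw [hsNorm, Real.sq_sqrt (by positivity), Finset.sum_comm]
  exact Finset.sum_congr rfl fun j _ => (sum_inner_sq_of_reproduces (hT j)).symm

theorem hsNorm_nonneg (φ : Fin n → H) (T : H →ₗ[ℝ] H) : 0 ≤ hsNorm φ T := Real.sqrt_nonneg _

theorem inner_self_le_hsNorm_mul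
    (hT : ∀ j, ∑ i, ⟪φ i, T (φ j)⟫_ℝ • φ i = T (φ j))
    {f : H} (hf : ∑ i, ⟪φ i, f⟫_ℝ • φ i = f) : ⟪f, T f⟫_ℝ ≤ hsNorm φ T * ‖f‖ ^ 2 := by
  have h : ⟪f, T f⟫_ℝ = ∑ i, ⟪φ i, f⟫_ℝ * ⟪f, T (φ i)⟫_ℝ := by
    conv_lhs => rw [← hf, map_sum, hf]
    simp [inner_sum, real_inner_smul_right]
  refine le_of_sq_le_sq ?_ (by have := hsNorm_nonneg φ T; positivity)
  rw [h]
  refine (Finset.sum_mul_sq_le_sq_mul_sq _ _ _).trans ?_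
  rw [sum_inner_sq_of_reproduces hf, mul_pow, ← sum_norm_sq_eq_hsNorm_sq hT]
  calc ‖f‖ ^ 2 * ∑ i, ⟪f, T (φ i)⟫_ℝ ^ 2 ≤ ‖f‖ ^ 2 * ∑ i, ‖f‖ ^ 2 * ‖T (φ i)‖ ^ 2 := by
        gcongr with i
        rw [← mul_pow, ← sq_abs]
        exact pow_le_pow_left₀ (abs_nonneg _) (abs_real_inner_le_norm _ _) 2
    _ = _ := by rw [← Finset.mul_sum]; ring

end hilbertSchmidt

variable {X : Type u} {H : Type v} [NormedAddCommGroup H] [InnerProductSpace ℝ H]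
  [CompleteSpace H] [RKHS ℝ H X ℝ] {n m : ℕ} {x : Fin n → X}

theorem kfun_eq_synthesis (i : Fin n) :
    kfun H (x i) = synthesis H x (EuclideanSpace.single i 1) := by
  simp [synthesis_apply]

theorem kfun_mem_range_synthesis (i : Fin n) : kfun H (x i) ∈ LinearMap.range (synthesis H x) :=
  ⟨_, (kfun_eq_synthesis i).symm⟩

theorem range_synthesis_comp_le (s : Fin m → Fin n) :
    LinearMap.range (synthesis H (x ∘ s)) ≤ LinearMap.range (synthesis H x) := by
  rintro _ ⟨a, rfl⟩
  rw [synthesis_apply]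
  exact Submodule.sum_mem _ fun i _ =>
    Submodule.smul_mem _ _ (kfun_mem_range_synthesis (H := H) (s i))

theorem integralOp_sub_mem (s : Fin m → Fin n) (f : H) :
    (integralOp H x - integralOp H (x ∘ s)) f ∈ LinearMap.range (synthesis H x) := by
  rw [LinearMap.sub_apply, integralOp_eq, integralOp_eq]
  exact Submodule.sub_mem _ (Submodule.smul_mem _ _ ⟨_, rfl⟩)
    (Submodule.smul_mem _ _ (range_synthesis_comp_le (H := H) s ⟨_, rfl⟩))

theorem eigenfun_mem_range_synthesis
    (w : OrthonormalBasis (Fin n) ℝ (EuclideanSpace ℝ (Fin n))) (lam : Fin n → ℝ) (j : Fin n) :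
    eigenfun H x w lam j ∈ LinearMap.range (synthesis H x) := by
  rw [eigenfun_eq]
  exact Submodule.smul_mem _ _ ⟨_, rfl⟩

variable {V : OrthonormalBasis (Fin n) ℝ (EuclideanSpace ℝ (Fin n))} {lam : Fin n → ℝ}

theorem IsEigensystem.sum_inner_eigenfun_smul (hV : IsEigensystem (kernelMatrix H x x) V lam)
    {f : H} (hf : f ∈ LinearMap.range (synthesis H x)) :
    ∑ i, ⟪eigenfun H x V lam i, f⟫_ℝ • eigenfun H x V lam i = f := by
  obtain ⟨a, rfl⟩ := hf
  exact hV.sum_inner_eigenfun_smul_synthesis a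

/-- Upper Rayleigh bound: `‖sampling x f‖²` is `n` times the quadratic form of the integral operator
at `f`, and the hypothesis says that `f` is orthogonal to the eigenfunctions of index below `l`. -/
theorem IsEigensystem.norm_sampling_sq_le (hV : IsEigensystem (kernelMatrix H x x) V lam)
    (l : Fin n) (f : H) (hf : ∀ i < l, ⟪V i, sampling x f⟫_ℝ = 0) :
    ‖sampling x f‖ ^ 2 ≤ lam l * ‖f‖ ^ 2 := by
  set g := sampling x f with hg
  have h1 : ‖synthesis H x g‖ ^ 2 ≤ lam l * ‖g‖ ^ 2 := by
    rw [← real_inner_self_eq_norm_sq, inner_synthesis_right, ← V.sum_inner_mul_inner,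
      ← V.sum_sq_norm_inner_right g, Finset.mul_sum]
    refine Finset.sum_le_sum fun i _ => ?_
    rw [hV.inner_sampling_synthesis, Real.norm_eq_abs, sq_abs, mul_assoc, ← sq]
    rcases lt_or_ge i l with h | h
    · simp [hf i h]
    · exact mul_le_mul_of_nonneg_right (hV.antitone h) (sq_nonneg _)
  have h2 : ‖g‖ ^ 2 ≤ ‖f‖ * ‖synthesis H x g‖ := by
    rw [← real_inner_self_eq_norm_sq]
    conv_lhs => rw [hg]
    rw [← inner_synthesis_right]
    exact real_inner_le_norm _ _
  have h3 : (‖g‖ ^ 2) ^ 2 ≤ ‖f‖ ^ 2 * (lam l * ‖g‖ ^ 2) :=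
    calc (‖g‖ ^ 2) ^ 2 ≤ (‖f‖ * ‖synthesis H x g‖) ^ 2 := pow_le_pow_left₀ (by positivity) h2 2
      _ = ‖f‖ ^ 2 * ‖synthesis H x g‖ ^ 2 := mul_pow _ _ _
      _ ≤ _ := mul_le_mul_of_nonneg_left h1 (by positivity)
  rcases (sq_nonneg ‖g‖).eq_or_lt with h | h
  · rw [← h]; exact mul_nonneg (hV.eigenvalue_nonneg l) (sq_nonneg _)
  · nlinarith

/-- Weyl's inequality for the normalized eigenvalues of the kernel matrices. -/
theorem eigenvalue_sub_hsNorm_le (hV : IsEigensystem (kernelMatrix H x x) V lam)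
    {s : Fin m → Fin n} {U : OrthonormalBasis (Fin m) ℝ (EuclideanSpace ℝ (Fin m))}
    {mu : Fin m → ℝ} (hU : IsEigensystem (kernelMatrix H (x ∘ s) (x ∘ s)) U mu)
    {l : ℕ} (hln : l < n) (hlm : l < m) (hpos : 0 < lam ⟨l, hln⟩) :
    lam ⟨l, hln⟩ / n - hsNorm (eigenfun H x V lam) (integralOp H x - integralOp H (x ∘ s))
      ≤ mu ⟨l, hlm⟩ / m := by
  set φ := eigenfun H x V lam with hφ
  set T := integralOp H x - integralOp H (x ∘ s) with hT
  let c : Fin (l + 1) → Fin n := Fin.castLE hln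
  have hc : ∀ j, lam ⟨l, hln⟩ ≤ lam (c j) := fun j =>
    hV.antitone (by rw [Fin.le_def]; exact Nat.lt_succ_iff.1 j.2)
  have hon : Orthonormal ℝ fun j => φ (c j) := by
    rw [orthonormal_iff_ite]
    intro i j
    rw [hφ, hV.inner_eigenfun _ _ (hpos.trans_le (hc i))]
    simp [c]
  -- By dimension count some nonzero `f` in the span of the `l + 1` leading eigenfunctions is
  -- orthogonal to the `l` leading sample eigenfunctions.
  let A : (Fin (l + 1) → ℝ) →ₗ[ℝ] (Fin l → ℝ) := LinearMap.pi fun i =>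
    (innerₛₗ ℝ (U (Fin.castLE hlm.le i))) ∘ₗ sampling (x ∘ s) ∘ₗ
      Fintype.linearCombination ℝ fun j => φ (c j)
  obtain ⟨a, ha, ha0⟩ := Submodule.exists_mem_ne_zero_of_ne_bot
    (A.ker_ne_bot_of_finrank_lt (by simp))
  set f := ∑ j, a j • φ (c j) with hfdef
  have hfl : Fintype.linearCombination ℝ (fun j => φ (c j)) a = f := by
    simp [Fintype.linearCombination_apply, hfdef]
  have hfm : f ∈ LinearMap.range (synthesis H x) := Submodule.sum_mem _ fun j _ =>
    Submodule.smul_mem _ _ (eigenfun_mem_range_synthesis V lam _)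
  have hfU : ∀ i < (⟨l, hlm⟩ : Fin m), ⟪U i, sampling (x ∘ s) f⟫_ℝ = 0 := by
    intro i hi
    have := congrFun (LinearMap.mem_ker.1 ha) ⟨i, hi⟩
    rw [← hfl]
    simpa [A] using this
  have hnorm : ‖f‖ ^ 2 = ∑ j, a j ^ 2 := by
    rw [← real_inner_self_eq_norm_sq, hfdef, hon.inner_sum]
    simp [sq]
  have hfpos : 0 < ‖f‖ ^ 2 := by
    rw [hnorm]
    obtain ⟨j, hj⟩ := Function.ne_iff.1 ha0
    exact Finset.sum_pos' (fun i _ => sq_nonneg _) ⟨j, Finset.mem_univ _, by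
      have : a j ≠ 0 := hj
      positivity⟩
  have hlow : lam ⟨l, hln⟩ / n * ‖f‖ ^ 2 ≤ ⟪f, integralOp H x f⟫_ℝ := by
    have h1 : integralOp H x f = ∑ j, (a j * (lam (c j) / n)) • φ (c j) := by
      rw [hfdef, map_sum]
      refine Finset.sum_congr rfl fun j _ => ?_
      rw [map_smul, hφ, hV.integralOp_eigenfun, smul_smul]
    rw [h1, hfdef, hon.inner_sum, ← hfdef, hnorm, Finset.mul_sum]
    refine Finset.sum_le_sum fun j _ => ?_
    have := div_le_div_of_nonneg_right (hc j) (Nat.cast_nonneg (α := ℝ) n)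
    simp only [conj_trivial]
    nlinarith [mul_le_mul_of_nonneg_right this (sq_nonneg (a j))]
  have hup : ⟪f, integralOp H (x ∘ s) f⟫_ℝ ≤ mu ⟨l, hlm⟩ / m * ‖f‖ ^ 2 := by
    rw [inner_integralOp_right, real_inner_self_eq_norm_sq]
    have := mul_le_mul_of_nonneg_left (hU.norm_sampling_sq_le ⟨l, hlm⟩ f hfU)
      (inv_nonneg.2 (Nat.cast_nonneg (α := ℝ) m))
    calc _ ≤ _ := this
      _ = _ := by ring
  have hmid := inner_self_le_hsNorm_mul (φ := φ) (T := T)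
    (fun j => hV.sum_inner_eigenfun_smul (integralOp_sub_mem s _)) (hV.sum_inner_eigenfun_smul hfm)
  have hT' : ⟪f, T f⟫_ℝ = ⟪f, integralOp H x f⟫_ℝ - ⟪f, integralOp H (x ∘ s) f⟫_ℝ := by
    rw [hT, LinearMap.sub_apply, inner_sub_right]
  have : (lam ⟨l, hln⟩ / n - hsNorm φ T) * ‖f‖ ^ 2 ≤ mu ⟨l, hlm⟩ / m * ‖f‖ ^ 2 := by
    rw [sub_mul]; linarith
  exact le_of_mul_le_mul_right this hfpos

/-- The Davis–Kahan estimate: on a pair of eigenfunctions the difference of the operators acts as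
the difference of the eigenvalues times the inner product. -/
theorem sum_inner_eigenfun_sq_le (hV : IsEigensystem (kernelMatrix H x x) V lam)
    {s : Fin m → Fin n} {U : OrthonormalBasis (Fin m) ℝ (EuclideanSpace ℝ (Fin m))}
    {mu : Fin m → ℝ} (hU : IsEigensystem (kernelMatrix H (x ∘ s) (x ∘ s)) U mu)
    {r : ℕ} {κ : Type*} [Fintype κ] (e : κ → Fin m)
    (hon : Orthonormal ℝ fun k => eigenfun H (x ∘ s) U mu (e k))
    {g : ℝ} (hg0 : 0 ≤ g)
    (hg : ∀ i : Fin n, r ≤ i → ∀ k, g ≤ mu (e k) / m - lam i / n) :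
    g ^ 2 * (∑ i : Fin n, ∑ k, if (i : ℕ) < r then 0
      else ⟪eigenfun H x V lam i, eigenfun H (x ∘ s) U mu (e k)⟫_ℝ ^ 2)
      ≤ hsNorm (eigenfun H x V lam) (integralOp H x - integralOp H (x ∘ s)) ^ 2 := by
  rw [← sum_norm_sq_eq_hsNorm_sq
    (fun j => hV.sum_inner_eigenfun_smul (integralOp_sub_mem s _)), Finset.mul_sum]
  refine Finset.sum_le_sum fun i _ => ?_
  refine le_trans ?_ (sum_inner_sq_le_norm_sq hon _)
  rw [Finset.mul_sum]
  refine Finset.sum_le_sum fun k _ => ?_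
  split_ifs with hi
  · rw [mul_zero]; exact sq_nonneg _
  · have h1 : ⟪(integralOp H x - integralOp H (x ∘ s)) (eigenfun H x V lam i),
        eigenfun H (x ∘ s) U mu (e k)⟫_ℝ = (lam i / n - mu (e k) / m) *
          ⟪eigenfun H x V lam i, eigenfun H (x ∘ s) U mu (e k)⟫_ℝ := by
      rw [LinearMap.sub_apply, inner_sub_left, inner_integralOp_symm (x := x ∘ s),
        hU.integralOp_eigenfun, hV.integralOp_eigenfun, real_inner_smul_left,
        real_inner_smul_right]
      ring
    rw [h1, mul_pow]
    refine mul_le_mul_of_nonneg_right ?_ (sq_nonneg _)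
    have := hg i (not_lt.1 hi) k
    nlinarith

end Nystrom

/-! ### Concentration of sample averages in inner product spaces -/

namespace Nystrom

/-- A form of Hoeffding's lemma for the uniform distribution on `Fin N`. Symmetrization with an
independent copy and `cosh t ≤ exp (t ^ 2 / 2)` give the constant `1 / 2` in place of `1 / 8`. -/
theorem sum_exp_div_le_exp_mean_add {N : ℕ} (hN : 0 < N) {g : Fin N → ℝ} {c : ℝ}
    (hg : ∀ i j, |g i - g j| ≤ c) :
    (∑ i, Real.exp (g i)) / N ≤ Real.exp ((∑ i, g i) / N + c ^ 2 / 2) := by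
  have hN' : (0 : ℝ) < N := Nat.cast_pos.2 hN
  -- Jensen's inequality for the independent copy.
  have hJ : Real.exp (-((∑ i, g i) / N)) ≤ (∑ j, Real.exp (-g j)) / N := by
    have := convexOn_exp.map_sum_le (t := Finset.univ) (w := fun _ : Fin N => (N : ℝ)⁻¹)
      (p := fun j => -g j) (fun _ _ => by positivity)
      (by simp [hN'.ne']) (fun _ _ => Set.mem_univ _)
    simp only [smul_eq_mul, ← Finset.mul_sum, Finset.sum_neg_distrib] at this
    convert! this using 1
    · congr 1; ring
    · ring
  have hC : ∑ i, ∑ j, Real.exp (g i - g j) ≤ N * (N * Real.exp (c ^ 2 / 2)) := by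
    have h1 : ∑ i, ∑ j, Real.exp (g i - g j) = ∑ i, ∑ j, Real.cosh (g i - g j) := by
      have h2 : ∑ i, ∑ j, Real.exp (g i - g j) = ∑ i, ∑ j, Real.exp (-(g i - g j)) := by
        rw [Finset.sum_comm]; simp
      simp_rw [Real.cosh_eq, add_div, Finset.sum_add_distrib, ← Finset.sum_div]
      rw [← h2]; ring
    rw [h1]
    calc ∑ i, ∑ j, Real.cosh (g i - g j) ≤ ∑ _i : Fin N, ∑ _j : Fin N, Real.exp (c ^ 2 / 2) := by
          gcongr with i _ j _
          refine (Real.cosh_le_exp_half_sq _).trans (Real.exp_le_exp.2 ?_)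
          rw [← sq_abs]
          gcongr
          exact hg i j
      _ = _ := by simp
  rw [Real.exp_add, ← div_le_iff₀' (Real.exp_pos _), div_eq_mul_inv, ← Real.exp_neg]
  calc (∑ i, Real.exp (g i)) / N * Real.exp (-((∑ i, g i) / N))
      ≤ (∑ i, Real.exp (g i)) / N * ((∑ j, Real.exp (-g j)) / N) := by gcongr
    _ = (∑ i, ∑ j, Real.exp (g i - g j)) / (N * N) := by
        rw [div_mul_div_comm, Finset.sum_mul_sum]
        simp_rw [sub_eq_add_neg, Real.exp_add]
    _ ≤ N * (N * Real.exp (c ^ 2 / 2)) / (N * N) := by gcongr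
    _ = _ := by field_simp

/-- The expectation of `F` over `m` independent uniform indices in `Fin N`, as a finite average. -/
noncomputable def sampleMean {N : ℕ} (m : ℕ) (F : (Fin m → Fin N) → ℝ) : ℝ :=
  (∑ s, F s) / (N : ℝ) ^ m

theorem sampleMean_mono {N m : ℕ} {F G : (Fin m → Fin N) → ℝ} (h : ∀ s, F s ≤ G s) :
    sampleMean m F ≤ sampleMean m G :=
  div_le_div_of_nonneg_right (Finset.sum_le_sum fun s _ => h s) (by positivity)

/-- Conditioning on the first of the `m + 1` independent indices. -/
theorem sampleMean_succ {N m : ℕ} (F : (Fin (m + 1) → Fin N) → ℝ) :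
    sampleMean (m + 1) F = (∑ k, sampleMean m fun t => F (Fin.cons k t)) / N := by
  simp only [sampleMean, ← Finset.sum_div]
  rw [← (Fin.consEquiv fun _ => Fin N).sum_comp, Fintype.sum_prod_type, div_div, pow_succ]
  rfl

theorem sampleMean_add_const {N m : ℕ} (hN : 0 < N) (F : (Fin m → Fin N) → ℝ) (c : ℝ) :
    sampleMean m (fun s => F s + c) = sampleMean m F + c := by
  have : (N : ℝ) ≠ 0 := by positivity
  simp only [sampleMean, Finset.sum_add_distrib, add_div]
  simp [this]

section

variable {E : Type*} [NormedAddCommGroup E]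

/-- Bounded-difference inequality for the norm of a random walk, on the level of exponential
moments: each step changes the conditional expectation of the final norm by at most `c`. -/
theorem sampleMean_exp_norm_le {N : ℕ} (hN : 0 < N) {η : Fin N → E} {c : ℝ}
    (hη : ∀ i j, ‖η i - η j‖ ≤ c) (m : ℕ) (v : E) :
    sampleMean m (fun s => Real.exp ‖v + ∑ i, η (s i)‖) ≤
      Real.exp (sampleMean m (fun s => ‖v + ∑ i, η (s i)‖) + m * (c ^ 2 / 2)) := by
  induction m generalizing v with
  | zero => simp [sampleMean]
  | succ m ih =>
    set G : E → ℝ := fun v => sampleMean m (fun s => ‖v + ∑ i, η (s i)‖) with hG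
    -- The conditional expectation is 1-Lipschitz in the current position.
    have hLip : ∀ v w : E, G v - G w ≤ ‖v - w‖ := by
      intro v w
      rw [sub_le_iff_le_add, add_comm, hG]
      simp only
      rw [← sampleMean_add_const hN]
      refine sampleMean_mono fun s => ?_
      have := norm_add_le (w + ∑ i, η (s i)) (v - w)
      rwa [show w + ∑ i, η (s i) + (v - w) = v + ∑ i, η (s i) by abel] at this
    have hosc : ∀ i j, |G (v + η i) - G (v + η j)| ≤ c := by
      intro i j
      rw [abs_le]
      have h1 := (hLip (v + η i) (v + η j)).trans ((by simpa using hη i j))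
      have h2 := (hLip (v + η j) (v + η i)).trans ((by simpa using hη j i))
      constructor <;> linarith
    rw [sampleMean_succ, sampleMean_succ]
    simp only [Fin.sum_univ_succ, Fin.cons_zero, Fin.cons_succ, ← add_assoc]
    calc (∑ k, sampleMean m fun t => Real.exp ‖v + η k + ∑ i, η (t i)‖) / N
        ≤ (∑ k, Real.exp (G (v + η k) + m * (c ^ 2 / 2))) / N := by
          gcongr with k
          exact ih _
      _ = (∑ k, Real.exp (G (v + η k))) / N * Real.exp (m * (c ^ 2 / 2)) := by
          simp_rw [Real.exp_add, ← Finset.sum_mul]; ring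
      _ ≤ Real.exp ((∑ k, G (v + η k)) / N + c ^ 2 / 2) * Real.exp (m * (c ^ 2 / 2)) := by
          gcongr
          exact sum_exp_div_le_exp_mean_add hN hosc
      _ = _ := by
          rw [← Real.exp_add]; congr 1; push_cast; ring

variable [InnerProductSpace ℝ E]

theorem sampleMean_norm_sq {N : ℕ} (hN : 0 < N) {η : Fin N → E} {b : ℝ}
    (h0 : ∑ i, η i = 0) (hb : (∑ i, ‖η i‖ ^ 2) / N = b) (m : ℕ) (v : E) :
    sampleMean m (fun s => ‖v + ∑ i, η (s i)‖ ^ 2) = ‖v‖ ^ 2 + m * b := by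
  have hN' : (N : ℝ) ≠ 0 := by positivity
  induction m generalizing v with
  | zero => simp [sampleMean]
  | succ m ih =>
    rw [sampleMean_succ]
    simp only [Fin.sum_univ_succ, Fin.cons_zero, Fin.cons_succ, ← add_assoc, ih]
    simp only [norm_add_sq_real, Finset.sum_add_distrib, ← Finset.mul_sum, ← inner_sum, h0]
    rw [add_div, add_div, hb]
    simp only [Finset.sum_const, Finset.card_univ, Fintype.card_fin, nsmul_eq_mul,
      inner_zero_right, mul_zero, add_zero]
    field_simp
    push_cast
    ring

theorem sampleMean_norm_le {N : ℕ} (hN : 0 < N) {η : Fin N → E} {b : ℝ}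
    (h0 : ∑ i, η i = 0) (hb : (∑ i, ‖η i‖ ^ 2) / N ≤ b) (m : ℕ) :
    sampleMean m (fun s => ‖∑ i, η (s i)‖) ≤ √(m * b) := by
  have hN' : (0 : ℝ) < N := Nat.cast_pos.2 hN
  have h := sampleMean_norm_sq hN h0 rfl m (0 : E)
  simp only [zero_add, norm_zero] at h
  refine Real.le_sqrt_of_sq_le ?_
  calc sampleMean m (fun s => ‖∑ i, η (s i)‖) ^ 2
      ≤ sampleMean m (fun s => ‖∑ i, η (s i)‖ ^ 2) := by
        have := sq_sum_le_card_mul_sum_sq (s := Finset.univ)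
          (f := fun s : Fin m → Fin N => ‖∑ i, η (s i)‖)
        simp only [Finset.card_univ, Fintype.card_fun, Fintype.card_fin, Nat.cast_pow] at this
        rw [sampleMean, sampleMean, div_pow, sq ((N : ℝ) ^ m), div_le_div_iff₀ (by positivity)
          (by positivity)]
        nlinarith [mul_le_mul_of_nonneg_right this (pow_pos hN' m).le]
    _ ≤ _ := by
        rw [h]
        have := mul_le_mul_of_nonneg_left hb (Nat.cast_nonneg (α := ℝ) m)
        linarith

/-- Dimension-free Hoeffding bound: the deviation of a sample average of vectors in the unit ball
has mean at most `1 / √m` and sub-Gaussian fluctuations around it. -/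
theorem sampleMean_tail_le {N m : ℕ} (hN : 0 < N) (hm : 0 < m) {ξ : Fin N → E}
    (hξ : ∀ i, ‖ξ i‖ ≤ 1) {L : ℝ} (hL : 1 / 4 ≤ L) :
    sampleMean m (fun s => if 4 * L / √m ≤ ‖(N : ℝ)⁻¹ • ∑ i, ξ i - (m : ℝ)⁻¹ • ∑ i, ξ (s i)‖
      then 1 else 0) ≤ Real.exp (-((4 * L - 1) ^ 2 / 8)) := by
  have hN' : (N : ℝ) ≠ 0 := by positivity
  have hm' : (0 : ℝ) < m := Nat.cast_pos.2 hm
  have hsm : 0 < √(m : ℝ) := Real.sqrt_pos.2 hm'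
  have hsq : √(m : ℝ) * √m = m := Real.mul_self_sqrt hm'.le
  set a : E := (N : ℝ)⁻¹ • ∑ i, ξ i with ha
  -- The minimizer of `-4 L τ + τ + 2 τ ^ 2` is `τ = (4 L - 1) / 4`; here `θ = τ / √m`.
  set θ : ℝ := (4 * L - 1) / 4 / √m with hθ
  have hθ0 : 0 ≤ θ := by
    rw [hθ]; apply div_nonneg _ hsm.le; linarith
  have hNa : ∑ i, ξ i = (N : ℝ) • a := by rw [ha, smul_smul, mul_inv_cancel₀ hN', one_smul]
  set η : Fin N → E := fun i => θ • (a - ξ i) with hη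
  have h0 : ∑ i, η i = 0 := by
    rw [hη, ← Finset.smul_sum, Finset.sum_sub_distrib, hNa]
    simp [← Nat.cast_smul_eq_nsmul ℝ]
  have hc : ∀ i j, ‖η i - η j‖ ≤ 2 * θ := by
    intro i j
    rw [hη]
    simp only
    rw [← smul_sub, norm_smul, Real.norm_of_nonneg hθ0, sub_sub_sub_cancel_left, mul_comm]
    gcongr
    refine (norm_sub_le _ _).trans ?_
    linarith [hξ i, hξ j]
  have hb : (∑ i, ‖η i‖ ^ 2) / N ≤ θ ^ 2 := by
    have h1 : ∑ i, ‖a - ξ i‖ ^ 2 = ∑ i, ‖ξ i‖ ^ 2 - N * ‖a‖ ^ 2 := by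
      simp only [norm_sub_sq_real, Finset.sum_add_distrib, Finset.sum_sub_distrib,
        ← Finset.mul_sum, ← inner_sum, hNa, real_inner_smul_right, real_inner_self_eq_norm_sq]
      simp
      ring
    have h2 : ∑ i, ‖ξ i‖ ^ 2 ≤ N := by
      calc ∑ i, ‖ξ i‖ ^ 2 ≤ ∑ _i : Fin N, (1 : ℝ) :=
            Finset.sum_le_sum fun i _ => pow_le_one₀ (norm_nonneg _) (hξ i)
        _ = N := by simp
    rw [div_le_iff₀ (by positivity), hη]
    simp only [norm_smul, mul_pow, Real.norm_eq_abs, sq_abs, ← Finset.mul_sum]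
    gcongr
    rw [h1]
    have : 0 ≤ (N : ℝ) * ‖a‖ ^ 2 := by positivity
    linarith
  have hsum : ∀ s : Fin m → Fin N,
      ‖∑ i, η (s i)‖ = θ * m * ‖a - (m : ℝ)⁻¹ • ∑ i, ξ (s i)‖ := by
    intro s
    have : ∑ i, η (s i) = (θ * m) • (a - (m : ℝ)⁻¹ • ∑ i, ξ (s i)) := by
      rw [hη, ← Finset.smul_sum, Finset.sum_sub_distrib, mul_smul, smul_sub (m : ℝ),
        smul_inv_smul₀ hm'.ne']
      simp [← Nat.cast_smul_eq_nsmul ℝ]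
    rw [this, norm_smul, Real.norm_of_nonneg (by positivity)]
  have hmean := sampleMean_norm_le hN h0 hb m
  have hexp := sampleMean_exp_norm_le hN hc m 0
  simp only [zero_add] at hexp
  have hθm : √(m * θ ^ 2) = (4 * L - 1) / 4 := by
    rw [Real.sqrt_mul hm'.le, Real.sqrt_sq hθ0, hθ, mul_div_cancel₀ _ hsm.ne']
  have hmθ : (m : ℝ) * θ ^ 2 = ((4 * L - 1) / 4) ^ 2 := by
    rw [← hθm, Real.sq_sqrt (by positivity)]
  calc _ ≤ sampleMean m (fun s => Real.exp (-(4 * L * ((4 * L - 1) / 4))) *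
        Real.exp ‖∑ i, η (s i)‖) := by
        refine sampleMean_mono fun s => ?_
        rw [← Real.exp_add]
        split_ifs with h
        · rw [Real.one_le_exp_iff, hsum]
          have h1 := mul_le_mul_of_nonneg_left h (mul_nonneg hθ0 hm'.le)
          have h2 : θ * m * (4 * L / √m) = 4 * L * ((4 * L - 1) / 4) := by
            rw [← hθm, Real.sqrt_mul hm'.le, Real.sqrt_sq hθ0]
            rw [← hsq]
            field_simp
            rw [Real.sqrt_sq hsm.le]
          linarith
        · exact (Real.exp_pos _).le
    _ = Real.exp (-(4 * L * ((4 * L - 1) / 4))) *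
        sampleMean m (fun s => Real.exp ‖∑ i, η (s i)‖) := by
        simp only [sampleMean, ← Finset.mul_sum, mul_div_assoc]
    _ ≤ Real.exp (-(4 * L * ((4 * L - 1) / 4))) *
        Real.exp (√(m * θ ^ 2) + m * ((2 * θ) ^ 2 / 2)) := by
        gcongr
        exact hexp.trans (Real.exp_le_exp.2 (by linarith))
    _ = _ := by
        rw [← Real.exp_add, hθm]
        congr 1
        linear_combination 2 * hmθ

end

theorem sampleLaw_real_singleton {N m : ℕ} (s : Fin m → Fin N) :
    (sampleLaw N m).real {s} = ((N : ℝ) ^ m)⁻¹ := by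
  have hfin : IsFiniteMeasure (ProbabilityTheory.uniformOn (Set.univ : Set (Fin N))) := by
    unfold ProbabilityTheory.uniformOn; infer_instance
  rw [sampleLaw, measureReal_def, Measure.pi_singleton]
  simp [ProbabilityTheory.uniformOn_univ]

instance isProbabilityMeasure_sampleLaw {N m : ℕ} [NeZero N] :
    IsProbabilityMeasure (sampleLaw N m) := by
  have : IsProbabilityMeasure (ProbabilityTheory.uniformOn (Set.univ : Set (Fin N))) :=
    ProbabilityTheory.isProbabilityMeasure_uniformOn Set.finite_univ Set.univ_nonempty
  unfold sampleLaw; infer_instance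

open Classical in
theorem sampleLaw_real_eq_sampleMean {N m : ℕ} [NeZero N] (p : (Fin m → Fin N) → Prop) :
    (sampleLaw N m).real {s | p s} = sampleMean m fun s => if p s then 1 else 0 := by
  have h := sum_measureReal_singleton (μ := sampleLaw N m) (Finset.univ.filter p)
  rw [show {s | p s} = ((Finset.univ.filter p : Finset _) : Set (Fin m → Fin N)) by simp, ← h,
    sampleMean]
  simp_rw [sampleLaw_real_singleton]
  simp [div_eq_mul_inv]

/-- With probability at least `1 - δ`, the average of `m` independent uniform samples from vectors
in the unit ball deviates from the population average by less than `4 log (2 / δ) / √m`. -/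
theorem ofReal_one_sub_le_sampleLaw {E : Type*} [NormedAddCommGroup E] [InnerProductSpace ℝ E]
    {N m : ℕ} (hN : 0 < N) (hm : 0 < m) {ξ : Fin N → E}
    (hξ : ∀ i, ‖ξ i‖ ≤ 1) {δ : ℝ} (hδ0 : 0 < δ) (hδ1 : δ < 1) :
    ENNReal.ofReal (1 - δ) ≤ sampleLaw N m {s |
      ‖(N : ℝ)⁻¹ • ∑ i, ξ i - (m : ℝ)⁻¹ • ∑ i, ξ (s i)‖ < 4 * Real.log (2 / δ) / √m} := by
  have : NeZero N := ⟨hN.ne'⟩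
  set L := Real.log (2 / δ) with hL
  have hLδ : L = Real.log 2 - Real.log δ := Real.log_div two_ne_zero hδ0.ne'
  have hδneg : Real.log δ < 0 := Real.log_neg hδ0 hδ1
  have hlog2 := Real.log_two_gt_d9
  have htail := sampleMean_tail_le hN hm hξ (L := L) (by linarith)
  have hexp : Real.exp (-((4 * L - 1) ^ 2 / 8)) ≤ δ := by
    rw [← Real.le_log_iff_exp_le hδ0]
    -- `(4 L - 1) ^ 2 / 8 ≥ L - log 2` since the difference is `((4 L - 2) ^ 2 - 3) / 8 + log 2`.
    nlinarith [sq_nonneg (4 * L - 2)]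
  have hbad := sampleLaw_real_eq_sampleMean (m := m) fun s : Fin m → Fin N =>
    4 * L / √m ≤ ‖(N : ℝ)⁻¹ • ∑ i, ξ i - (m : ℝ)⁻¹ • ∑ i, ξ (s i)‖
  rw [ENNReal.ofReal_le_iff_le_toReal (measure_ne_top _ _), ← measureReal_def]
  have hcompl := probReal_compl_eq_one_sub (μ := sampleLaw N m)
    (s := {s | 4 * L / √m ≤ ‖(N : ℝ)⁻¹ • ∑ i, ξ i - (m : ℝ)⁻¹ • ∑ i, ξ (s i)‖})
    (Set.toFinite _).measurableSet
  rw [show {s : Fin m → Fin N | ‖(N : ℝ)⁻¹ • ∑ i, ξ i - (m : ℝ)⁻¹ • ∑ i, ξ (s i)‖ < 4 * L / √m}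
    = {s | 4 * L / √m ≤ ‖(N : ℝ)⁻¹ • ∑ i, ξ i - (m : ℝ)⁻¹ • ∑ i, ξ (s i)‖}ᶜ by
      ext s; simp, hcompl, hbad]
  have : (sampleMean m fun s : Fin m → Fin N => open Classical in if 4 * L / √m ≤
      ‖(N : ℝ)⁻¹ • ∑ i, ξ i - (m : ℝ)⁻¹ • ∑ i, ξ (s i)‖ then (1 : ℝ) else 0) ≤ δ := by
    refine le_trans (le_of_eq ?_) (htail.trans hexp)
    congr!
  linarith

end Nystrom

/-! ### The Nyström approximation -/

namespace Nystrom

section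

variable {X : Type u} {H : Type v} [NormedAddCommGroup H] [InnerProductSpace ℝ H]
  [CompleteSpace H] [RKHS ℝ H X ℝ] {N m : ℕ} {x : Fin N → X}
  {V : OrthonormalBasis (Fin N) ℝ (EuclideanSpace ℝ (Fin N))} {lam : Fin N → ℝ}

theorem IsEigensystem.inner_eigenfun_kfun (hV : IsEigensystem (kernelMatrix H x x) V lam)
    (l i : Fin N) : ⟪eigenfun H x V lam l, kfun H (x i)⟫_ℝ = √(lam l) * V l i := by
  have h := congrFun (hV.mulVec_eq l) i
  rw [real_inner_comm, inner_kfun_eigenfun]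
  simp only [Matrix.mulVec, dotProduct, kernelMatrix, Matrix.of_apply, Pi.smul_apply,
    smul_eq_mul] at h
  rw [h, ← mul_assoc, ← div_eq_inv_mul, Real.div_sqrt]

/-- The best approximation of `K` is the Gram matrix of the kernel functions projected to the span
of the leading eigenfunctions. -/
theorem IsEigensystem.spectralTruncation_apply
    (hV : IsEigensystem (kernelMatrix H x x) V lam) {r : ℕ} (hrN : r ≤ N) (i j : Fin N) :
    spectralTruncation V lam r hrN i j = ∑ l : Fin N, if (l : ℕ) < r then
      ⟪eigenfun H x V lam l, kfun H (x i)⟫_ℝ * ⟪eigenfun H x V lam l, kfun H (x j)⟫_ℝ else 0 := by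
  rw [← sum_fin_castLE hrN fun l =>
    ⟪eigenfun H x V lam l, kfun H (x i)⟫_ℝ * ⟪eigenfun H x V lam l, kfun H (x j)⟫_ℝ]
  simp only [spectralTruncation, Matrix.sum_apply, Matrix.smul_apply, Matrix.vecMulVec_apply,
    smul_eq_mul]
  refine Finset.sum_congr rfl fun l _ => ?_
  rw [hV.inner_eigenfun_kfun, hV.inner_eigenfun_kfun, mul_mul_mul_comm,
    Real.mul_self_sqrt (hV.eigenvalue_nonneg _)]

/-- The Nyström approximation is the Gram matrix of the kernel functions projected to the span of
the leading eigenfunctions of the sample operator. -/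
theorem nystromApprox_apply {y : Fin m → X}
    {U : OrthonormalBasis (Fin m) ℝ (EuclideanSpace ℝ (Fin m))} {mu : Fin m → ℝ}
    (hU : IsEigensystem (kernelMatrix H y y) U mu) {r : ℕ} (hrm : r ≤ m) (i j : Fin N) :
    nystromApprox H x y U mu r hrm i j = ∑ l : Fin r,
      ⟪eigenfun H y U mu (Fin.castLE hrm l), kfun H (x i)⟫_ℝ *
      ⟪eigenfun H y U mu (Fin.castLE hrm l), kfun H (x j)⟫_ℝ := by
  have h : ∀ i (l : Fin m), ⟪eigenfun H y U mu l, kfun H (x i)⟫_ℝ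
      = (√(mu l))⁻¹ * (kernelMatrix H x y *ᵥ (U l).ofLp) i := by
    intro i l
    rw [real_inner_comm, inner_kfun_eigenfun]
    rfl
  simp only [h, nystromApprox, Matrix.mul_sum, Matrix.sum_mul, Matrix.sum_apply]
  refine Finset.sum_congr rfl fun l _ => ?_
  rw [mul_mul_mul_comm, ← mul_inv, Real.mul_self_sqrt (hU.eigenvalue_nonneg _),
    Matrix.mul_smul, Matrix.smul_mul, Matrix.smul_apply, Matrix.mul_vecMulVec,
    Matrix.vecMulVec_mul, Matrix.vecMulVec_apply, Matrix.vecMul_transpose, smul_eq_mul]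

theorem frobenius_norm_le_of_entries {A : Matrix (Fin N) (Fin N) ℝ} {t : ℝ} (ht : 0 ≤ t)
    (h : ∀ i j, A i j ^ 2 ≤ t ^ 2) : ‖A‖ ≤ N * t := by
  refine le_of_sq_le_sq ?_ (by positivity)
  rw [frobenius_norm_sq]
  calc ∑ i, ∑ j, A i j ^ 2 ≤ ∑ _i : Fin N, ∑ _j : Fin N, t ^ 2 :=
        Finset.sum_le_sum fun i _ => Finset.sum_le_sum fun j _ => h i j
    _ = _ := by simp; ring

/-- The deterministic bound, with the constant `√2` that the argument yields and for the full range
`ε < Δ`. -/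
theorem norm_sub_nystromApprox_le {r : ℕ} (hrm : r ≤ m) (hrN : r < N) (hr : 1 ≤ r)
    (hκ : ∀ i, kappa H (x i) (x i) ≤ 1)
    (hV : IsEigensystem (kernelMatrix H x x) V lam)
    {Kr : Matrix (Fin N) (Fin N) ℝ} (hKr : IsBestRankApprox (kernelMatrix H x x) r Kr)
    {s : Fin m → Fin N}
    {U : OrthonormalBasis (Fin m) ℝ (EuclideanSpace ℝ (Fin m))} {mu : Fin m → ℝ}
    (hU : IsEigensystem (kernelMatrix H (x ∘ s) (x ∘ s)) U mu)
    {Δ ε : ℝ} (hΔ : Δ = eigengap lam r hrN)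
    (hε : ε = hsNorm (eigenfun H x V lam) (integralOp H x - integralOp H (x ∘ s)))
    (h : ε < Δ) :
    0 < mu ⟨r - 1, by omega⟩ ∧
      ‖Kr - nystromApprox H x (x ∘ s) U mu r hrm‖ ≤ √2 * (N * ε / (Δ - ε)) := by
  have hN' : (0 : ℝ) < N := Nat.cast_pos.2 (by omega)
  have hm' : (0 : ℝ) < m := Nat.cast_pos.2 (by omega)
  have hε0 : 0 ≤ ε := hε ▸ hsNorm_nonneg _ _
  have hΔ' : lam ⟨r - 1, by omega⟩ / N - lam ⟨r, hrN⟩ / N = Δ := by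
    rw [hΔ, eigengap, sub_div]
  have hgap : lam ⟨r, hrN⟩ < lam ⟨r - 1, by omega⟩ := by
    have : 0 < lam ⟨r - 1, by omega⟩ / N - lam ⟨r, hrN⟩ / N := by linarith
    rwa [← sub_div, div_pos_iff_of_pos_right hN', sub_pos] at this
  have hlam : 0 < lam ⟨r - 1, by omega⟩ := (hV.eigenvalue_nonneg _).trans_lt hgap
  have hweyl := eigenvalue_sub_hsNorm_le hV hU (l := r - 1) (by omega) (by omega) hlam
  rw [← hε] at hweyl
  have hlow : Δ - ε ≤ mu ⟨r - 1, by omega⟩ / m - lam ⟨r, hrN⟩ / N := by linarith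
  have hmu : 0 < mu ⟨r - 1, by omega⟩ := by
    have h1 : 0 ≤ lam ⟨r, hrN⟩ / N := div_nonneg (hV.eigenvalue_nonneg _) hN'.le
    rw [← div_pos_iff_of_pos_right hm']
    linarith
  refine ⟨hmu, ?_⟩
  have hmul : ∀ l : Fin r, mu ⟨r - 1, by omega⟩ ≤ mu (Fin.castLE hrm l) := fun l =>
    hU.antitone (by rw [Fin.le_def]; simp only [Fin.val_castLE]; omega)
  have hon : Orthonormal ℝ fun l : Fin r => eigenfun H (x ∘ s) U mu (Fin.castLE hrm l) := by
    rw [orthonormal_iff_ite]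
    intro i j
    rw [hU.inner_eigenfun _ _ (hmu.trans_le (hmul i))]
    simp
  -- By Weyl's inequality the leading sample eigenvalues stay `Δ - ε` above `λ_{r+1} / N`.
  have hDK := sum_inner_eigenfun_sq_le hV hU (r := r) (Fin.castLE hrm) hon
    (g := Δ - ε) (by linarith) (by
      intro i hi l
      have h1 : lam i / N ≤ lam ⟨r, hrN⟩ / N :=
        div_le_div_of_nonneg_right (hV.antitone (by rw [Fin.le_def]; exact hi)) hN'.le
      have h2 : mu ⟨r - 1, by omega⟩ / m ≤ mu (Fin.castLE hrm l) / m :=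
        div_le_div_of_nonneg_right (hmul l) hm'.le
      linarith)
  rw [← hε] at hDK
  have hgpos : 0 < Δ - ε := by linarith
  rw [hKr.eq_spectralTruncation hV hV.eigenvalue_nonneg hr hrN hgap,
    show √2 * (N * ε / (Δ - ε)) = N * (√2 * (ε / (Δ - ε))) by ring]
  refine frobenius_norm_le_of_entries (by positivity) fun i j => ?_
  rw [Matrix.sub_apply, hV.spectralTruncation_apply, nystromApprox_apply hU]
  have hk : ∀ i, ‖kfun H (x i)‖ ^ 2 ≤ 1 := fun i => by
    rw [← real_inner_self_eq_norm_sq, inner_kfun_kfun]; exact hκ i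
  refine (sq_spectralProjection_sub_le (fun l : Fin N => (l : ℕ) < r) hon ?_ ?_ ?_
    (hV.sum_inner_eigenfun_smul (kfun_mem_range_synthesis i)) _).trans ?_
  · intro l hl
    have hll : lam ⟨r - 1, by omega⟩ ≤ lam l :=
      hV.antitone (by rw [Fin.le_def]; simp only; omega)
    have := hV.inner_eigenfun l l (hlam.trans_le hll)
    rw [if_pos rfl, real_inner_self_eq_norm_sq] at this
    exact (pow_eq_one_iff_of_nonneg (norm_nonneg _) two_ne_zero).1 this
  · exact fun l => hV.sum_inner_eigenfun_smul
      (range_synthesis_comp_le s (eigenfun_mem_range_synthesis _ _ _))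
  · rw [← sum_fin_castLE hrN.le fun _ => 1]; simp
  · rw [mul_pow, Real.sq_sqrt zero_le_two, div_pow]
    refine (mul_le_of_le_one_right (by positivity)
      (mul_le_one₀ (hk i) (sq_nonneg _) (hk j))).trans ?_
    gcongr
    rw [le_div_iff₀ (by positivity), mul_comm]
    exact hDK

theorem four_mul_div_sub_le {n Δ ε : ℝ} (hn : 0 ≤ n) (hε : 0 ≤ ε) (h : 3 * ε < Δ) :
    4 * n * ε / (Δ - ε) ≤ 6 * n * ε / Δ := by
  rw [div_le_div_iff₀ (by linarith) (by linarith)]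
  nlinarith [mul_nonneg (mul_nonneg hn hε) (sub_nonneg.2 h.le)]

theorem sqrt_two_mul_div_sub_le {n Δ ε : ℝ} (hn : 0 ≤ n) (hε : 0 ≤ ε) (h : ε < Δ) :
    √2 * (n * ε / (Δ - ε)) ≤ 4 * n * ε / (Δ - ε) := by
  have h2 : √2 ≤ 4 := by rw [Real.sqrt_le_left (by norm_num)]; norm_num
  rw [show 4 * n * ε / (Δ - ε) = 4 * (n * ε / (Δ - ε)) by ring]
  have : 0 ≤ n * ε / (Δ - ε) := div_nonneg (mul_nonneg hn hε) (by linarith)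
  gcongr

/-- The coefficients `⟪φ i, κ_z⟫ ⟪κ_z, φ j⟫` of the rank-one operator `f ↦ f(z) κ_z` along the
family `φ`. The Euclidean norm of a coefficient vector is the Hilbert–Schmidt norm `hsNorm φ`, which
makes the empirical integral operators into averages in a Euclidean space. -/
noncomputable def rankOneCoeff (φ : Fin N → H) (z : X) : EuclideanSpace ℝ (Fin N × Fin N) :=
  WithLp.toLp 2 fun p => ⟪φ p.1, kfun H z⟫_ℝ * ⟪kfun H z, φ p.2⟫_ℝ

theorem norm_rankOneCoeff_le {φ : Fin N → H} {z : X}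
    (hz : ∑ i, ⟪φ i, kfun H z⟫_ℝ • φ i = kfun H z) (hκ : kappa H z z ≤ 1) :
    ‖rankOneCoeff φ z‖ ≤ 1 := by
  have h1 := sum_inner_sq_of_reproduces hz
  rw [← real_inner_self_eq_norm_sq, inner_kfun_kfun] at h1
  have h0 : 0 ≤ kappa H z z := by rw [← inner_kfun_kfun]; exact real_inner_self_nonneg
  refine le_of_sq_le_sq ?_ zero_le_one
  rw [EuclideanSpace.norm_sq_eq, Fintype.sum_prod_type]
  simp only [rankOneCoeff, Real.norm_eq_abs, sq_abs, mul_pow, ← Finset.mul_sum,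
    real_inner_comm (φ _) (kfun H z)]
  simp only [real_inner_comm (kfun H z) (φ _)] at h1 ⊢
  rw [← Finset.sum_mul, h1, one_pow]
  exact mul_le_one₀ hκ h0 hκ

/-- The operator error is the deviation of a sample average from the population average. -/
theorem hsNorm_integralOp_sub (φ : Fin N → H) (s : Fin m → Fin N) :
    hsNorm φ (integralOp H x - integralOp H (x ∘ s))
      = ‖(N : ℝ)⁻¹ • ∑ i, rankOneCoeff φ (x i) - (m : ℝ)⁻¹ • ∑ i, rankOneCoeff φ (x (s i))‖ := by
  have h : ∀ {n : ℕ} (y : Fin n → X) (i j : Fin N), ⟪φ i, integralOp H y (φ j)⟫_ℝ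
      = ((n : ℝ)⁻¹ • ∑ k, rankOneCoeff φ (y k)) (i, j) := by
    intro n y i j
    simp [integralOp, inner_smul_right, inner_sum, rankOneCoeff, inner_kfun_left, mul_comm]
  rw [hsNorm, EuclideanSpace.norm_eq, Fintype.sum_prod_type]
  simp [inner_sub_right, h]

end

end Nystrom

theorem theorem5 :
    -- the deterministic bound, for an arbitrary choice `s` of the sampled points
    (∀ (X : Type u) (H : Type v) [NormedAddCommGroup H] [InnerProductSpace ℝ H] [CompleteSpace H]
        [RKHS ℝ H X ℝ] (N m r : ℕ) (_hr : 1 ≤ r) (hrN : r < N) (hrm : r ≤ m)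
        (x : Fin N → X) (_hκ : ∀ i, kappa H (x i) (x i) ≤ 1)
        (V : OrthonormalBasis (Fin N) ℝ (EuclideanSpace ℝ (Fin N))) (lam : Fin N → ℝ)
        (_hV : IsEigensystem (kernelMatrix H x x) V lam)
        (Kr : Matrix (Fin N) (Fin N) ℝ) (_hKr : IsBestRankApprox (kernelMatrix H x x) r Kr)
        (s : Fin m → Fin N)
        (U : OrthonormalBasis (Fin m) ℝ (EuclideanSpace ℝ (Fin m))) (mu : Fin m → ℝ)
        (_hU : IsEigensystem (kernelMatrix H (x ∘ s) (x ∘ s)) U mu)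
        (Δ ε : ℝ) (_hΔ : Δ = eigengap lam r hrN)
        (_hε : ε = hsNorm (eigenfun H x V lam) (integralOp H x - integralOp H (x ∘ s))),
        Δ > 3 * ε →
          0 < mu ⟨r - 1, by omega⟩ ∧
          ‖Kr - nystromApprox H x (x ∘ s) U mu r hrm‖ ≤ 4 * N * ε / (Δ - ε) ∧
          4 * N * ε / (Δ - ε) ≤ 6 * N * ε / Δ) ∧
    -- the probabilistic bound, for independent uniform samples; `C` depends on `c` and `δ` only
    (∀ c δ : ℝ, 0 < c → 0 < δ → δ < 1 → ∃ C : ℝ,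
      ∀ (X : Type u) (H : Type v) [NormedAddCommGroup H] [InnerProductSpace ℝ H] [CompleteSpace H]
        [RKHS ℝ H X ℝ] (N m r : ℕ) (_hr : 1 ≤ r) (hrN : r < N) (hrm : r ≤ m)
        (x : Fin N → X) (_hκ : ∀ i, kappa H (x i) (x i) ≤ 1)
        (V : OrthonormalBasis (Fin N) ℝ (EuclideanSpace ℝ (Fin N))) (lam : Fin N → ℝ)
        (_hV : IsEigensystem (kernelMatrix H x x) V lam)
        (Kr : Matrix (Fin N) (Fin N) ℝ) (_hKr : IsBestRankApprox (kernelMatrix H x x) r Kr)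
        (Δ : ℝ) (_hΔ : Δ = eigengap lam r hrN),
        c ≤ Δ → Δ > 12 * Real.log (2 / δ) / √(m : ℝ) →
          ENNReal.ofReal (1 - δ) ≤ sampleLaw N m {s |
            ∀ (U : OrthonormalBasis (Fin m) ℝ (EuclideanSpace ℝ (Fin m))) (mu : Fin m → ℝ),
              IsEigensystem (kernelMatrix H (x ∘ s) (x ∘ s)) U mu →
                0 < mu ⟨r - 1, by omega⟩ ∧
                ‖Kr - nystromApprox H x (x ∘ s) U mu r hrm‖ ≤ C * (N / √(m : ℝ))}) := by
  refine ⟨?_, ?_⟩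
  · intro X H _ _ _ _ N m r hr hrN hrm x hκ V lam hV Kr hKr s U mu hU Δ ε hΔ hε h
    have hε0 : 0 ≤ ε := hε ▸ hsNorm_nonneg _ _
    have hN0 : (0 : ℝ) ≤ N := Nat.cast_nonneg N
    obtain ⟨hmu, hle⟩ := norm_sub_nystromApprox_le hrm hrN hr hκ hV hKr hU hΔ hε (by linarith)
    exact ⟨hmu, hle.trans (sqrt_two_mul_div_sub_le hN0 hε0 (by linarith)),
      four_mul_div_sub_le hN0 hε0 h⟩
  · intro c δ hc hδ0 hδ1
    -- `6 N ε / Δ` with `ε ≤ 4 log (2 / δ) / √m` and `Δ ≥ c`.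
    refine ⟨24 * Real.log (2 / δ) / c, ?_⟩
    intro X H _ _ _ _ N m r hr hrN hrm x hκ V lam hV Kr hKr Δ hΔ hcΔ hΔm
    have hN0 : (0 : ℝ) ≤ N := Nat.cast_nonneg N
    refine (ofReal_one_sub_le_sampleLaw (N := N) (m := m) (by omega) (by omega)
      (ξ := fun i => rankOneCoeff (eigenfun H x V lam) (x i)) (fun i => norm_rankOneCoeff_le
        (hV.sum_inner_eigenfun_smul (kfun_mem_range_synthesis i)) (hκ i)) hδ0 hδ1).trans
      (measure_mono fun s hs U mu hU => ?_)
    rw [Set.mem_ofPred_eq, ← hsNorm_integralOp_sub] at hs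
    set ε := hsNorm (eigenfun H x V lam) (integralOp H x - integralOp H (x ∘ s)) with hε
    have hε0 : 0 ≤ ε := hsNorm_nonneg _ _
    have hbound : 0 ≤ 4 * Real.log (2 / δ) / √(m : ℝ) := hε0.trans hs.le
    have h3 : 3 * ε < Δ := by
      refine lt_trans ?_ hΔm
      rw [show 12 * Real.log (2 / δ) / √(m : ℝ) = 3 * (4 * Real.log (2 / δ) / √(m : ℝ)) by ring]
      linarith
    obtain ⟨hmu, hle⟩ := norm_sub_nystromApprox_le hrm hrN hr hκ hV hKr hU hΔ hε (by linarith)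
    refine ⟨hmu, hle.trans <| (sqrt_two_mul_div_sub_le hN0 hε0 (by linarith)).trans <|
      (four_mul_div_sub_le hN0 hε0 h3).trans ?_⟩
    calc 6 * N * ε / Δ ≤ 6 * N * (4 * Real.log (2 / δ) / √(m : ℝ)) / c := by gcongr
      _ = _ := by ring
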